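/- A necessity operator on a boolean algebra $B$ is a map $\Box\colon B\to B$ that preserves finite meets, i.e. $\Box 1=1$ and $\Box(a\wedge b)=\Box a\wedge\Box b$ for all $a,b\in B$. Let $\mathcal{NO}(B)$ be the set of necessity operators on $B$, ordered pointwise. When $B$ is complete, $\mathcal{NO}(B)$ is a complete lattice. A frame is a complete lattice satisfying $a\wedge\bigvee S=\bigvee\{a\wedge b\mid b\in S\}$ for every element $a$ and every subset $S$; a coframe is a complete lattice satisfying the dual law. A frame is locally Stone if it is zero-dimensional (every element is a join of complemented elements) and algebraic (every element is a join of compact elements). **Corollary.** Let $B$ be a complete atomic boolean algebra and let $M$ be its set of atoms, with the discrete topology. Then $\mathcal{NO}(B)$ is a locally Stone frame, and it is isomorphic to the frame $\Omega(M\times\beta M)$ of open subsets of $M\times\beta M$, where $\beta M$ is the Stone–Čech compactification of $M$. However, $\mathcal{NO}(\wp(\mathbb N))$ is not a coframe, is not completely distributive, and is not a boolean algebra. -/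

import Mathlib

universe u

/-- `NO B` is the set of necessity operators on a boolean algebra `B`, that is, of the maps
`B → B` that preserve finite meets (the empty meet `⊤` and binary meets). It carries Mathlib's
pointwise order: `f ≤ g` iff `f a ≤ g a` for all `a`. -/
abbrev NO (B : Type u) [BooleanAlgebra B] : Type u := InfTopHom B B

namespace NO

/-- The order on `NO B` is pointwise. -/
theorem le_iff {B : Type u} [BooleanAlgebra B] (f g : NO B) : f ≤ g ↔ ∀ a, f a ≤ g a :=
  Iff.rfl

/-- For complete `B`, arbitrary meets of necessity operators are computed pointwise. -/
instance instInfSet {B : Type u} [CompleteBooleanAlgebra B] : InfSet (NO B) where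
  sInf S :=
    { toFun := fun a => ⨅ f ∈ S, f a
      map_inf' := fun a b => by simp only [map_inf, iInf_inf_eq]
      map_top' := by simp only [map_top, iInf_top] }

theorem sInf_apply {B : Type u} [CompleteBooleanAlgebra B] (S : Set (NO B)) (a : B) :
    sInf S a = ⨅ f ∈ S, f a :=
  rfl

theorem isGLB_sInf' {B : Type u} [CompleteBooleanAlgebra B] (S : Set (NO B)) :
    IsGLB S (sInf S) :=
  ⟨fun _ hf a => iInf₂_le _ hf, fun _ hg a => le_iInf₂ fun _ hf => hg hf a⟩

/-- For complete `B`, the pointwise order makes `NO B` a complete lattice. -/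
instance instCompleteLattice {B : Type u} [CompleteBooleanAlgebra B] : CompleteLattice (NO B) where
  __ := (inferInstance : SemilatticeInf (NO B))
  __ := (inferInstance : OrderTop (NO B))
  __ := completeLatticeOfInf (NO B) isGLB_sInf'

end NO

/-- A complete lattice is a frame if it satisfies the join-infinite distributive law. -/
def IsFrame (L : Type u) [CompleteLattice L] : Prop :=
  ∀ (a : L) (S : Set L), a ⊓ sSup S = ⨆ b ∈ S, a ⊓ b

/-- A complete lattice is a coframe if it satisfies the meet-infinite distributive law. -/
def IsCoframe (L : Type u) [CompleteLattice L] : Prop :=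
  ∀ (a : L) (S : Set L), a ⊔ sInf S = ⨅ b ∈ S, a ⊔ b

/-- A complete lattice is completely distributive if arbitrary meets distribute over
arbitrary joins. -/
def IsCompletelyDistributive (L : Type u) [CompleteLattice L] : Prop :=
  ∀ (ι : Type u) (κ : ι → Type u) (f : ∀ i, κ i → L),
    (⨅ i, ⨆ j, f i j) = ⨆ g : ∀ i, κ i, ⨅ i, f i (g i)

/-- A bounded lattice is a boolean algebra if it is distributive and every element has a
complement. -/
def IsBooleanLattice (L : Type u) [Lattice L] [BoundedOrder L] : Prop :=
  (∀ a b c : L, a ⊓ (b ⊔ c) = (a ⊓ b) ⊔ (a ⊓ c)) ∧ ∀ a : L, IsComplemented a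

/-- Zero-dimensionality: every element is a join of complemented elements. -/
def IsZeroDimensionalLattice (L : Type u) [CompleteLattice L] : Prop :=
  ∀ a : L, ∃ S : Set L, (∀ c ∈ S, IsComplemented c) ∧ sSup S = a

/-- A locally Stone frame: a frame that is zero-dimensional and algebraic, the latter meaning that
every element is a join of compact elements (Mathlib's `IsCompactlyGenerated`). -/
structure IsLocallyStoneFrame (L : Type u) [CompleteLattice L] : Prop where
  isFrame : IsFrame L
  isZeroDimensional : IsZeroDimensionalLattice L
  isAlgebraic : IsCompactlyGenerated L

/-- The set of atoms of a boolean algebra, regarded below as a discrete topological space. -/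
def AtomSet (B : Type u) [BooleanAlgebra B] : Type u := {a : B // IsAtom a}

instance AtomSet.instTopologicalSpace (B : Type u) [BooleanAlgebra B] :
    TopologicalSpace (AtomSet B) := ⊥

instance AtomSet.instDiscreteTopology (B : Type u) [BooleanAlgebra B] :
    DiscreteTopology (AtomSet B) := ⟨rfl⟩

open TopologicalSpace

section LatticeTheory

variable {L K : Type u} [CompleteLattice L] [CompleteLattice K]

/-! A complete atomic `B` is the powerset of its atoms `M`, and an operator `□` amounts to the
filters `{A | m ≤ □A}`, one for each atom `m` (`NO.orderIsoFilter`). Under inclusion, filters on `M`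
are the opens of `βM`: a filter goes to the set of ultrafilters not refining it
(`Filter.dualOrderIsoOpens`). As `M` is discrete, `M`-indexed families of opens of `βM` are opens of
`M × βM`, a locally compact, totally disconnected Hausdorff space; hence the frame is locally Stone.
All three negative claims reduce to a failure of the coframe law, witnessed by constant families of
cofinite and principal filters (`not_isCoframe_NO_set`). -/

theorem IsCompletelyDistributive.isCoframe (h : IsCompletelyDistributive L) : IsCoframe L := by
  intro a S
  refine le_antisymm (le_iInf₂ fun b hb => sup_le_sup_left (sInf_le hb) a) ?_
  -- For each `b ∈ S`, choose `a` (`true`) or `b` (`false`): a choice function takes `a` somewhere,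
  -- or else takes every `b`.
  have key := h S (fun _ => ULift Bool) (fun b j => cond j.down a b.1)
  calc ⨅ b ∈ S, a ⊔ b ≤ ⨅ b : S, ⨆ j : ULift Bool, cond j.down a b.1 := by
        refine le_iInf fun b => (iInf₂_le b.1 b.2).trans (sup_le ?_ ?_)
        · exact le_iSup_of_le ⟨true⟩ le_rfl
        · exact le_iSup_of_le ⟨false⟩ le_rfl
    _ ≤ a ⊔ sInf S := by
        rw [key]
        refine iSup_le fun g => ?_
        by_cases hg : ∃ b, (g b).down = true
        · obtain ⟨b, hb⟩ := hg
          exact (iInf_le_of_le b (by rw [hb]; rfl)).trans le_sup_left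
        · push Not at hg
          refine le_sup_of_le_right (le_sInf fun b hb => iInf_le_of_le ⟨b, hb⟩ ?_)
          rw [Bool.eq_false_of_not_eq_true (hg ⟨b, hb⟩)]
          rfl

theorem IsBooleanLattice.isCoframe (h : IsBooleanLattice L) : IsCoframe L := by
  intro a S
  refine le_antisymm (le_iInf₂ fun b hb => sup_le_sup_left (sInf_le hb) a) ?_
  obtain ⟨c, hc⟩ := h.2 a
  set x := ⨅ b ∈ S, a ⊔ b
  have hx : x = (x ⊓ a) ⊔ (x ⊓ c) := by rw [← h.1, hc.sup_eq_top, inf_top_eq]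
  rw [hx]
  refine sup_le_sup inf_le_right (le_sInf fun b hb => ?_)
  calc x ⊓ c ≤ c ⊓ (a ⊔ b) := le_inf inf_le_right (inf_le_left.trans (iInf₂_le b hb))
    _ = (c ⊓ a) ⊔ (c ⊓ b) := h.1 _ _ _
    _ ≤ b := by rw [inf_comm c a, hc.inf_eq_bot, bot_sup_eq]; exact inf_le_right

theorem OrderIso.isCompactElement (e : L ≃o K) {k : L} (hk : IsCompactElement k) :
    IsCompactElement (e k) := by
  rw [CompleteLattice.isCompactElement_iff_exists_le_sSup_of_le_sSup] at hk ⊢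
  intro s hs
  classical
  obtain ⟨t, hts, ht⟩ := hk (e.symm '' s) (by
    rw [sSup_image, ← e.symm.map_sSup, e.le_symm_apply]; exact hs)
  refine ⟨t.image e, ?_, ?_⟩
  · intro y hy
    obtain ⟨x, hx, rfl⟩ := Finset.mem_image.1 hy
    obtain ⟨z, hz, rfl⟩ := hts hx
    simpa using hz
  · rw [Finset.sup_image]
    calc e k ≤ e (t.sup id) := e.monotone ht
      _ = t.sup (id ∘ e) := map_finset_sup e t id

theorem IsLocallyStoneFrame.of_orderIso (e : L ≃o K) (h : IsLocallyStoneFrame L) :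
    IsLocallyStoneFrame K where
  isFrame a S := by
    apply e.symm.injective
    have := h.isFrame (e.symm a) (e.symm '' S)
    simpa only [map_inf, e.symm.map_sSup, sSup_image, e.symm.map_iSup, iSup_image] using this
  isZeroDimensional a := by
    obtain ⟨S, hS, hSa⟩ := h.isZeroDimensional (e.symm a)
    refine ⟨e '' S, ?_, by rw [sSup_image, ← e.map_sSup, hSa, e.apply_symm_apply]⟩
    rintro _ ⟨c, hc, rfl⟩
    obtain ⟨d, hd⟩ := hS c hc
    exact ⟨e d, e.isCompl hd⟩
  isAlgebraic := ⟨fun a => by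
    obtain ⟨S, hS, hSa⟩ := h.isAlgebraic.exists_sSup_eq (e.symm a)
    refine ⟨e '' S, ?_, by rw [sSup_image, ← e.map_sSup, hSa, e.apply_symm_apply]⟩
    rintro _ ⟨c, hc, rfl⟩
    exact e.isCompactElement (hS c hc)⟩

end LatticeTheory

/-- Order isomorphic posets have order isomorphic powers. -/
def OrderIso.powerCongr (ι : Type*) {P Q : Type*} [LE P] [LE Q] (e : P ≃o Q) :
    (ι → P) ≃o (ι → Q) where
  toEquiv := Equiv.piCongrRight fun _ : ι => e.toEquiv
  map_rel_iff' := forall_congr' fun _ => e.map_rel_iff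

section OpenSets

variable {X : Type u} [TopologicalSpace X]

theorem TopologicalSpace.Opens.isComplemented_of_isClopen {U : Opens X}
    (hU : IsClopen (U : Set X)) : IsComplemented U := by
  refine ⟨⟨(U : Set X)ᶜ, hU.isClosed.isOpen_compl⟩, ?_⟩
  rw [isCompl_iff, disjoint_iff, codisjoint_iff]
  constructor <;> ext x <;> simp

theorem TopologicalSpace.Opens.exists_isCompact_isClopen_of_mem [T2Space X]
    [LocallyCompactSpace X] [TotallyDisconnectedSpace X] {U : Opens X} {x : X} (hx : x ∈ U) :
    ∃ V : Opens X, IsCompact (V : Set X) ∧ IsClopen (V : Set X) ∧ x ∈ V ∧ V ≤ U := by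
  obtain ⟨K, hK, hxK, hKU⟩ := exists_compact_subset U.isOpen hx
  obtain ⟨V, hV, hxV, hVK⟩ :=
    loc_compact_Haus_tot_disc_of_zero_dim.exists_subset_of_mem_open hxK isOpen_interior
  have hVK' := hVK.trans interior_subset
  exact ⟨⟨V, hV.isOpen⟩, hK.of_isClosed_subset hV.isClosed hVK', hV, hxV, hVK'.trans hKU⟩

/-- The frame of opens of a locally compact, totally disconnected Hausdorff space is
locally Stone. -/
theorem TopologicalSpace.Opens.isLocallyStoneFrame [T2Space X] [LocallyCompactSpace X]
    [TotallyDisconnectedSpace X] : IsLocallyStoneFrame (Opens X) := by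
  have key (U : Opens X) : ∃ S : Set (Opens X),
      (∀ V ∈ S, IsCompact (V : Set X) ∧ IsClopen (V : Set X)) ∧ sSup S = U := by
    refine ⟨{V | (IsCompact (V : Set X) ∧ IsClopen (V : Set X)) ∧ V ≤ U},
      fun V hV => hV.1, le_antisymm (sSup_le fun V hV => hV.2) fun x hx => ?_⟩
    obtain ⟨V, hVc, hV, hxV, hVU⟩ := Opens.exists_isCompact_isClopen_of_mem hx
    exact Opens.mem_sSup.2 ⟨V, ⟨⟨hVc, hV⟩, hVU⟩, hxV⟩
  refine ⟨fun a S => inf_sSup_eq, fun U => ?_, ⟨fun U => ?_⟩⟩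
  · obtain ⟨S, hS, hSU⟩ := key U
    exact ⟨S, fun V hV => Opens.isComplemented_of_isClopen (hS V hV).2, hSU⟩
  · obtain ⟨S, hS, hSU⟩ := key U
    exact ⟨S, fun V hV => (Opens.isCompactElement_iff V).2 (hS V hV).1, hSU⟩

/-- The opens of `M × Y` with `M` discrete are the `M`-indexed families of opens of `Y`. -/
def TopologicalSpace.Opens.piOrderIsoProd (M Y : Type*) [TopologicalSpace M] [DiscreteTopology M]
    [TopologicalSpace Y] : (M → Opens Y) ≃o Opens (M × Y) where
  toFun U := ⟨{p | p.2 ∈ U p.1}, by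
    have : {p : M × Y | p.2 ∈ U p.1} = ⋃ m, {m} ×ˢ (U m : Set Y) := by
      ext ⟨m, y⟩; simp
    rw [this]
    exact isOpen_iUnion fun m => (isOpen_discrete _).prod (U m).isOpen⟩
  invFun V m := ⟨{y | (m, y) ∈ V}, V.isOpen.preimage (Continuous.prodMk_right m)⟩
  left_inv U := rfl
  right_inv V := rfl
  map_rel_iff' := ⟨fun h m y hy => @h (m, y) hy, fun h p hp => h p.1 hp⟩

end OpenSets

section Ultrafilters

variable (M : Type u)

/-- Filters on `M`, ordered by inclusion, correspond to the open sets of ultrafilters on `M`. -/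
def Filter.dualOrderIsoOpens : (Filter M)ᵒᵈ ≃o Opens (Ultrafilter M) where
  toFun F := ⟨{u | ¬ (u : Filter M) ≤ F.ofDual}, by
    have : {u : Ultrafilter M | ¬ (u : Filter M) ≤ F.ofDual} =
        ⋃ A ∈ F.ofDual, {u : Ultrafilter M | A ∈ u}ᶜ := by
      ext u; simp [Filter.le_def]
    rw [this]
    exact isOpen_biUnion fun A _ => (ultrafilter_isClosed_basic A).isOpen_compl⟩
  invFun U := OrderDual.toDual
    { sets := {A | ∀ u : Ultrafilter M, u ∉ U → A ∈ u}
      univ_sets := fun u _ => Filter.univ_mem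
      sets_of_superset := fun hA hAB u hu => Filter.mem_of_superset (hA u hu) hAB
      inter_sets := fun hA hB u hu => Filter.inter_mem (hA u hu) (hB u hu) }
  left_inv F := by
    apply OrderDual.ofDual.injective
    ext A
    -- A filter is the intersection of the ultrafilters refining it.
    refine Iff.trans ?_ Filter.mem_iff_ultrafilter.symm
    exact forall_congr' fun u => imp_congr_left not_not
  right_inv U := by
    ext u
    constructor
    · exact fun h => by_contra fun hu => h fun A hA => hA u hu
    · intro hu h
      obtain ⟨_, ⟨s, rfl⟩, hs, hsU⟩ :=
        ultrafilterBasis_is_basis.exists_subset_of_mem_open hu U.isOpen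
      -- The basic open set of `s` lies in `U`, so every ultrafilter outside `U` contains `sᶜ`.
      have : sᶜ ∈ u := h fun v hv => Ultrafilter.compl_mem_iff_notMem.2 fun hsv => hv (hsU hsv)
      exact Ultrafilter.compl_mem_iff_notMem.1 this hs
  map_rel_iff' {F G} := by
    refine Iff.trans ?_ (Filter.le_iff_ultrafilter (f₁ := G.ofDual) (f₂ := F.ofDual)).symm
    exact forall_congr' fun u => not_imp_not

/-- The Stone–Čech compactification of a discrete space is its space of ultrafilters. -/
noncomputable def StoneCech.homeomorphUltrafilter [TopologicalSpace M] [DiscreteTopology M] :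
    StoneCech M ≃ₜ Ultrafilter M where
  toFun := stoneCechExtend (g := (pure : M → Ultrafilter M)) continuous_of_discreteTopology
  invFun := Ultrafilter.extend stoneCechUnit
  left_inv := congr_fun <| stoneCech_hom_ext
    ((continuous_ultrafilter_extend _).comp (continuous_stoneCechExtend _)) continuous_id <| by
      ext m; simp [stoneCechExtend_stoneCechUnit, ultrafilter_extend_pure]
  right_inv := congr_fun <| denseRange_pure.equalizer
    ((continuous_stoneCechExtend _).comp (continuous_ultrafilter_extend _)) continuous_id <| by
      ext m; simp [stoneCechExtend_stoneCechUnit, ultrafilter_extend_pure]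
  continuous_toFun := continuous_stoneCechExtend _
  continuous_invFun := continuous_ultrafilter_extend _

end Ultrafilters

section Operators

variable (B : Type u) [CompleteBooleanAlgebra B] [IsAtomic B]

/-- A complete atomic boolean algebra is the powerset of its set of atoms. -/
def AtomSet.orderIsoSet : B ≃o Set (AtomSet B) where
  toFun a := {m | m.1 ≤ a}
  invFun A := ⨆ m ∈ A, m.1
  left_inv a := le_antisymm (iSup₂_le fun _ hm => hm) <|
    BooleanAlgebra.le_iff_atom_le_imp.2 fun c hc hca =>
      le_iSup₂_of_le (f := fun (m : AtomSet B) (_ : m ∈ {m : AtomSet B | m.1 ≤ a}) => m.1)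
        ⟨c, hc⟩ hca le_rfl
  right_inv A := by
    ext m
    refine ⟨fun hm => by_contra fun hmA => m.2.1 ?_, fun hm => le_iSup₂_of_le m hm le_rfl⟩
    -- An atom below a join of other atoms is, by distributivity, a join of its meets with them, all
    -- `⊥`.
    rw [← le_bot_iff]
    refine (le_inf le_rfl hm).trans ?_
    rw [inf_iSup₂_eq]
    refine iSup₂_le fun n hn => ?_
    have hne : m.1 ≠ n.1 := fun h => hmA (by rwa [Subtype.ext h])
    exact (m.2.disjoint_of_ne n.2 hne).le_bot
  map_rel_iff' {a b} := ⟨fun h => BooleanAlgebra.le_iff_atom_le_imp.2 fun c hc hca =>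
    h (show (⟨c, hc⟩ : AtomSet B) ∈ {m : AtomSet B | m.1 ≤ a} from hca),
    fun h _ hm => le_trans hm h⟩

/-- A necessity operator on a complete atomic boolean algebra is a family of filters on the set
of atoms, indexed by the atoms. -/
def NO.orderIsoFilter : NO B ≃o (AtomSet B → (Filter (AtomSet B))ᵒᵈ) where
  -- A larger operator has larger families of sets, which Mathlib counts as smaller filters; hence
  -- the dual.
  toFun f m := OrderDual.toDual
    { sets := {A | m.1 ≤ f ((AtomSet.orderIsoSet B).symm A)}
      univ_sets := by
        change m.1 ≤ f ((AtomSet.orderIsoSet B).symm ⊤)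
        rw [map_top, map_top]
        exact le_top
      sets_of_superset := fun hA hAB =>
        le_trans hA (OrderHomClass.mono f ((AtomSet.orderIsoSet B).symm.monotone hAB))
      inter_sets := fun {A C} hA hC => by
        change m.1 ≤ f ((AtomSet.orderIsoSet B).symm (A ⊓ C))
        rw [map_inf, map_inf]
        exact le_inf hA hC }
  invFun G :=
    { toFun := fun a => (AtomSet.orderIsoSet B).symm
        {m | AtomSet.orderIsoSet B a ∈ (G m).ofDual}
      map_inf' := fun a b => by
        rw [← map_inf]
        congr 1
        ext m
        simp only [map_inf]
        exact Filter.inter_mem_iff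
      map_top' := by
        rw [← map_top (AtomSet.orderIsoSet B).symm]
        congr 1
        ext m
        simp only [map_top]
        exact iff_of_true Filter.univ_mem trivial }
  left_inv f := by
    ext a
    refine (OrderIso.symm_apply_eq _).2 (Set.ext fun m => ?_)
    change m.1 ≤ f ((AtomSet.orderIsoSet B).symm (AtomSet.orderIsoSet B a)) ↔ m.1 ≤ f a
    rw [OrderIso.symm_apply_apply]
  right_inv G := by
    funext m
    apply OrderDual.ofDual.injective
    ext A
    change m ∈ AtomSet.orderIsoSet B ((AtomSet.orderIsoSet B).symm
      {m | AtomSet.orderIsoSet B ((AtomSet.orderIsoSet B).symm A) ∈ (G m).ofDual}) ↔ _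
    rw [OrderIso.apply_symm_apply, OrderIso.apply_symm_apply]
    rfl
  map_rel_iff' {f g} := by
    constructor
    · intro h a
      refine (AtomSet.orderIsoSet B).le_iff_le.1 fun m hm => ?_
      have := h m (show AtomSet.orderIsoSet B a ∈
        {A | m.1 ≤ f ((AtomSet.orderIsoSet B).symm A)} by
          change m.1 ≤ f ((AtomSet.orderIsoSet B).symm (AtomSet.orderIsoSet B a))
          rw [OrderIso.symm_apply_apply]
          exact hm)
      change m.1 ≤ g ((AtomSet.orderIsoSet B).symm (AtomSet.orderIsoSet B a)) at this
      rwa [OrderIso.symm_apply_apply] at this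
    · exact fun h m A hA => le_trans hA (h _)

/-- The necessity operators on a complete atomic boolean algebra with set of atoms `M` are the
open sets of `M × βM`. -/
noncomputable def NO.orderIsoOpens :
    NO B ≃o Opens (AtomSet B × StoneCech (AtomSet B)) :=
  (NO.orderIsoFilter B).trans <|
    (OrderIso.powerCongr _ <| (Filter.dualOrderIsoOpens (AtomSet B)).trans
      (StoneCech.homeomorphUltrafilter (AtomSet B)).symm.opensCongr).trans
    (Opens.piOrderIsoProd (AtomSet B) (StoneCech (AtomSet B)))

theorem NO.isLocallyStoneFrame : IsLocallyStoneFrame (NO B) := by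
  have : TotallyDisconnectedSpace (StoneCech (AtomSet B)) :=
    (StoneCech.homeomorphUltrafilter (AtomSet B)).symm.totallyDisconnectedSpace
  exact Opens.isLocallyStoneFrame.of_orderIso (NO.orderIsoOpens B).symm

end Operators

section Counterexample

/-- The operator on `Set M` whose accessibility filter is `F` at every point. -/
def Filter.constOperator {M : Type u} (F : Filter M) : NO (Set M) where
  toFun A := {_m | A ∈ F}
  map_inf' _ _ := Set.ext fun _ => Filter.inter_mem_iff
  map_top' := Set.ext fun _ => iff_of_true Filter.univ_mem trivial

/-- On an infinite set `M`, the cofinite operator joined with any principal operator is `⊤`, while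
the meet of the principal operators is `⊥`. -/
theorem not_isCoframe_NO_set (M : Type u) [Infinite M] : ¬ IsCoframe (NO (Set M)) := by
  intro h
  have key := h (Filter.cofinite : Filter M).constOperator
    (Set.range fun n : M => (pure n : Filter M).constOperator)
  have hbot : sInf (Set.range fun n : M => (pure n : Filter M).constOperator) ≤
      (Filter.cofinite : Filter M).constOperator := by
    intro A x hx
    have hA : A = Set.univ := Set.eq_univ_of_forall fun n =>
      (sInf_le (Set.mem_range_self n) :
        sInf (Set.range fun n : M => (pure n : Filter M).constOperator) ≤ _) A hx
    subst hA
    exact (Filter.univ_mem : Set.univ ∈ (Filter.cofinite : Filter M))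
  have htop (n : M) :
      (Filter.cofinite : Filter M).constOperator ⊔ (pure n : Filter M).constOperator = ⊤ := by
    set c := (Filter.cofinite : Filter M).constOperator ⊔ (pure n : Filter M).constOperator
    have h1 : c {n} = ⊤ := top_le_iff.1 fun x _ =>
      (le_sup_right : (pure n : Filter M).constOperator ≤ c) {n}
        (show {n} ∈ (pure n : Filter M) from rfl)
    have h2 : c {n}ᶜ = ⊤ := top_le_iff.1 fun x _ =>
      (le_sup_left : (Filter.cofinite : Filter M).constOperator ≤ c) {n}ᶜ
        (Set.finite_singleton n).compl_mem_cofinite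
    -- `c` preserves the meet of `{n}` and its complement.
    have h3 : c ⊥ = ⊤ := by
      rw [← inf_compl_eq_bot (a := ({n} : Set M)), map_inf, h1, h2, inf_top_eq]
    exact top_le_iff.1 fun A => le_top.trans (h3.ge.trans (OrderHomClass.mono c bot_le))
  -- The coframe law would now make the cofinite operator `⊤`, yet `∅` is not cofinite in the
  -- infinite set `M`.
  rw [sup_eq_left.2 hbot, iInf_range] at key
  simp only [htop, iInf_top] at key
  obtain ⟨x⟩ : Nonempty M := inferInstance
  have : x ∈ (Filter.cofinite : Filter M).constOperator ∅ := by rw [key]; trivial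
  exact Filter.empty_notMem (Filter.cofinite : Filter M) this

end Counterexample

theorem mainTheorem5 :
    (∀ (B : Type u) [CompleteBooleanAlgebra B] [IsAtomic B],
      IsLocallyStoneFrame (NO B) ∧
        Nonempty (NO B ≃o TopologicalSpace.Opens (AtomSet B × StoneCech (AtomSet B)))) ∧
    ¬ IsCoframe (NO (Set ℕ)) ∧
    ¬ IsCompletelyDistributive (NO (Set ℕ)) ∧
    ¬ IsBooleanLattice (NO (Set ℕ)) :=
  ⟨fun B _ _ => ⟨NO.isLocallyStoneFrame B, ⟨NO.orderIsoOpens B⟩⟩, not_isCoframe_NO_set ℕ,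
    fun h => not_isCoframe_NO_set ℕ h.isCoframe, fun h => not_isCoframe_NO_set ℕ h.isCoframe⟩
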